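/- For $n\ge 1$ let $X_n$ denote the number of blocks in a set partition chosen uniformly at random among all partitions of $\{1,2,\dots,n\}$ into non-empty blocks. For $x>0$ let $W(x)$ denote the principal branch of the Lambert $W$-function, i.e. the unique positive solution $w$ of $we^w=x$, and put \[ \mu_n:=\frac{n}{W(n)},\qquad \sigma_n^2:=\frac{n}{W(n)\,(W(n)+1)}. \] Then, as $n\to\infty$, the mean and the variance of $X_n$ satisfy \[ \mathbb{E}(X_n)=\mu_n+O(W(n)),\qquad \mathbb{V}(X_n)=\sigma_n^2+O\bigl(W(n)^2\bigr). \] -/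

import Mathlib

open MeasureTheory ProbabilityTheory Filter Asymptotics

namespace StirlingPartition

/-- Partitions of an `n`-element set into non-empty, pairwise disjoint blocks. -/
abbrev SetPartition (n : ℕ) : Type := Finpartition (Finset.univ : Finset (Fin n))

/-- Every set of partitions is an event. -/
instance instMeasurableSpaceSetPartition (n : ℕ) : MeasurableSpace (SetPartition n) := ⊤

/-- The uniform distribution on all partitions of an `n`-element set. -/
noncomputable def uniformPartition (n : ℕ) : Measure (SetPartition n) :=
  (PMF.uniformOfFintype (SetPartition n)).toMeasure

/-- The random variable `X_n`: the number of blocks of a partition, as a real number. -/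
def numBlocks (n : ℕ) (P : SetPartition n) : ℝ := (P.parts.card : ℝ)

/-- The mean `E(X_n)`. -/
noncomputable def meanBlocks (n : ℕ) : ℝ := ∫ P, numBlocks n P ∂(uniformPartition n)

/-- The variance `V(X_n)`. -/
noncomputable def varBlocks (n : ℕ) : ℝ := variance (numBlocks n) (uniformPartition n)

/-- The (real) principal branch of the Lambert `W`-function: the inverse of `w ↦ w * exp w`
on `[-1, ∞)`. Its values at `x < -1/e` are irrelevant. -/
noncomputable def lambertW (x : ℝ) : ℝ :=
  Function.invFunOn (fun w : ℝ => w * Real.exp w) (Set.Ici (-1)) x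

theorem strictMonoOn_mul_exp :
    StrictMonoOn (fun w : ℝ => w * Real.exp w) (Set.Ici (-1)) := by
  apply strictMonoOn_of_deriv_pos (convex_Ici _) (by fun_prop)
  intro w hw
  rw [interior_Ici, Set.mem_Ioi] at hw
  have h : HasDerivAt (fun w : ℝ => w * Real.exp w) (1 * Real.exp w + w * Real.exp w) w :=
    (hasDerivAt_id w).mul (Real.hasDerivAt_exp w)
  rw [h.deriv]
  nlinarith [Real.exp_pos w]

/-- For `x > 0`, `lambertW x` is positive and solves `w * exp w = x`. -/
theorem lambertW_spec {x : ℝ} (hx : 0 < x) :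
    0 < lambertW x ∧ lambertW x * Real.exp (lambertW x) = x := by
  have hex : ∃ w ∈ Set.Ici (-1 : ℝ), (fun w : ℝ => w * Real.exp w) w = x := by
    have hc : ContinuousOn (fun w : ℝ => w * Real.exp w) (Set.Icc 0 x) := by fun_prop
    have hm : x ∈ Set.Icc ((fun w : ℝ => w * Real.exp w) 0)
        ((fun w : ℝ => w * Real.exp w) x) := by
      refine ⟨by simpa using hx.le, ?_⟩
      have := Real.one_le_exp hx.le
      change x ≤ x * Real.exp x
      nlinarith
    obtain ⟨w, hw, h⟩ := intermediate_value_Icc hx.le hc hm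
    exact ⟨w, by simpa using (by linarith [hw.1] : (-1 : ℝ) ≤ w), h⟩
  have h : lambertW x * Real.exp (lambertW x) = x := Function.invFunOn_eq hex
  refine ⟨?_, h⟩
  by_contra hn
  nlinarith [Real.exp_pos (lambertW x)]

/-- For `x > 0`, `lambertW x` is the only positive solution of `w * exp w = x`. -/
theorem eq_lambertW {x w : ℝ} (hx : 0 < x) (hw : 0 < w) (h : w * Real.exp w = x) :
    w = lambertW x := by
  obtain ⟨h1, h2⟩ := lambertW_spec hx
  refine strictMonoOn_mul_exp.injOn (by simpa using (by linarith : (-1 : ℝ) ≤ w))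
    (by simpa using (by linarith : (-1 : ℝ) ≤ lambertW x)) ?_
  simp only [h, h2]

/-- `μ_n = n / W(n)`. -/
noncomputable def mu (n : ℕ) : ℝ := n / lambertW n

/-- `σ_n² = n / (W(n) (W(n) + 1))`. -/
noncomputable def sigmaSq (n : ℕ) : ℝ := n / (lambertW n * (lambertW n + 1))

end StirlingPartition

/-! Let `K = X_n + N`, where `N` is an independent Poisson variable of rate `1`; adding `N` raises
the mean and the variance by `1`. Sorting the maps `Fin n → Fin k` by their fibres gives
`k ^ n = ∑ P, k.descFactorial |P|`, so that `ℙ(K = k)` is proportional to `k ^ n / k!`. Hence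
`𝔼 g(K + 1) = 𝔼 q(K) g(K)` for every `g`, with `q(k) = k (1 - 1 / k) ^ n`.

Write `n = W * exp W` and `m = exp W`. Up to an error of order `W / m`, the difference `q(k) - 1`
has the sign of `k - m` and size at least of order `|k - m| / m`. The identity for
`g(k) = (k - m) ^ (2 i + 1)` therefore bounds `𝔼 (K - m) ^ (2 i + 2)` by a multiple of
`m * (1 + 𝔼 (K - m) ^ (2 i))`, whence `𝔼 |K - m| ^ i = O(m ^ (i / 2))`. Replacing `q` by its
quadratic Taylor polynomial at `m`, the identity for `g(k) = (k - m) ^ j` becomes an approximate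
linear relation between the moments `e_j`, `e_(j+1)`, `e_(j+2)` of `K` about `m`. It yields
`e_1 = O(W)` for `j = 0`, then `e_3 = O(m W)` for `j = 2`, and with these two bounds
`e_2 = m / (W + 1) + O(W ^ 2)` for `j = 1`. -/

namespace StirlingPartition

section Colourings

variable {α β : Type*} [Fintype α] [DecidableEq α]

theorem eq_of_part_eq {P Q : Finpartition (Finset.univ : Finset α)}
    (h : ∀ a, P.part a = Q.part a) : P = Q := by
  have image_part (R : Finpartition (Finset.univ : Finset α)) :
      Set.image R.part (Finset.univ : Finset α) = (R.parts : Set (Finset α)) :=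
    R.part_surjOn.image_eq_of_mapsTo (fun a _ => R.part_mem.2 (Finset.mem_univ a))
  ext t
  rw [← Finset.mem_coe, ← Finset.mem_coe, ← image_part, ← image_part, funext h]

/-- The function on `α` that is constant on the blocks of a partition and takes distinct values on
distinct blocks, as prescribed by an injective choice of one value per block. -/
def blockColouring (x : Σ P : Finpartition (Finset.univ : Finset α), P.parts ↪ β) (a : α) : β :=
  x.2 ⟨x.1.part a, x.1.part_mem.2 (Finset.mem_univ a)⟩

theorem blockColouring_eq_iff (x : Σ P : Finpartition (Finset.univ : Finset α), P.parts ↪ β)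
    (a b : α) : blockColouring x a = blockColouring x b ↔ x.1.part a = x.1.part b := by
  simp only [blockColouring, x.2.injective.eq_iff, Subtype.mk.injEq]

theorem blockColouring_injective :
    Function.Injective (blockColouring (α := α) (β := β)) := by
  rintro ⟨P, e⟩ ⟨Q, e'⟩ h
  obtain rfl : P = Q := eq_of_part_eq fun a => by
    ext b
    rw [P.mem_part_iff_part_eq_part (Finset.mem_univ _) (Finset.mem_univ _),
      Q.mem_part_iff_part_eq_part (Finset.mem_univ _) (Finset.mem_univ _),
      ← blockColouring_eq_iff ⟨P, e⟩, ← blockColouring_eq_iff ⟨Q, e'⟩, h]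
  congr 1
  ext ⟨t, ht⟩
  obtain ⟨a, ha⟩ := P.nonempty_of_mem_parts ht
  simpa only [blockColouring, P.part_eq_of_mem ht ha] using congrFun h a

theorem blockColouring_surjective :
    Function.Surjective (blockColouring (α := α) (β := β)) := by
  classical
  intro f
  let P := Finpartition.ofSetoid (Setoid.ker f)
  have mem_part {a b : α} : b ∈ P.part a ↔ f a = f b := Finpartition.mem_part_ofSetoid_iff_rel
  choose c hc using fun t : P.parts => P.nonempty_of_mem_parts t.2
  have f_comp_c_injective : Function.Injective fun t => f (c t) := fun t u htu =>
    Subtype.ext (P.eq_of_mem_parts t.2 u.2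
      (P.part_eq_of_mem t.2 (hc t) ▸ mem_part.2 htu) (hc u))
  exact ⟨⟨P, _, f_comp_c_injective⟩, funext fun a => (mem_part.1 (hc _)).symm⟩

theorem card_pow_card_eq_sum_descFactorial [Fintype β] :
    Fintype.card β ^ Fintype.card α =
      ∑ P : Finpartition (Finset.univ : Finset α), (Fintype.card β).descFactorial P.parts.card := by
  classical
  have h := Fintype.card_of_bijective
    (⟨blockColouring_injective, blockColouring_surjective⟩ :
      Function.Bijective (blockColouring (α := α) (β := β)))
  simpa [Fintype.card_sigma, Fintype.card_embedding_eq] using h.symm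

end Colourings

theorem integral_eq_tsum (ν : Measure ℕ) [IsFiniteMeasure ν] (f : ℕ → ℝ) :
    ∫ k, f k ∂ν = ∑' k, ν.real {k} * f k := by
  conv_lhs => rw [← Measure.sum_smul_dirac ν]
  exact integral_sum_dirac (measure_ne_top ν {·})

theorem integral_mul_succ_eq {ν : Measure ℕ} [IsFiniteMeasure ν] {p q : ℕ → ℝ} (hq₀ : q 0 = 0)
    (hpq : ∀ k, p k * ν.real {k} = q (k + 1) * ν.real {k + 1}) (g : ℕ → ℝ) :
    ∫ k, p k * g (k + 1) ∂ν = ∫ k, q k * g k ∂ν := by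
  rw [integral_eq_tsum, integral_eq_tsum,
    ← Nat.succ_injective.tsum_eq (f := fun k => _ * (q k * _))]
  · exact tsum_congr fun k => by linear_combination g (k + 1) * hpq k
  · intro k hk
    cases k with
    | zero => simp [hq₀] at hk
    | succ k => exact ⟨k, rfl⟩

section Poisson

open scoped NNReal

theorem integrable_exp_mul_poissonMeasure (r : ℝ≥0) (t : ℝ) :
    Integrable (fun k : ℕ => Real.exp (t * k)) (poissonMeasure r) := by
  rw [integrable_poissonMeasure_iff]
  refine ((Real.summable_pow_div_factorial (r * Real.exp t)).mul_left (Real.exp (-r))).congr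
    fun k => ?_
  rw [Real.norm_of_nonneg (Real.exp_pos _).le, mul_pow, ← Real.exp_nat_mul]
  ring_nf

theorem memLp_natCast_poissonMeasure (r p : ℝ≥0) :
    MemLp (fun k : ℕ => (k : ℝ)) p (poissonMeasure r) := by
  refine memLp_of_mem_interior_integrableExpSet ?_ p
  have integrableExpSet_eq : integrableExpSet (fun k : ℕ => (k : ℝ)) (poissonMeasure r) = .univ :=
    Set.eq_univ_of_forall (integrable_exp_mul_poissonMeasure r)
  simp [integrableExpSet_eq]

theorem integral_natCast_mul_poissonMeasure (r : ℝ≥0) (g : ℕ → ℝ) :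
    ∫ k, (k : ℝ) * g k ∂poissonMeasure r = r * ∫ k, g (k + 1) ∂poissonMeasure r := by
  rw [← integral_const_mul, integral_mul_succ_eq (p := fun _ => r) Nat.cast_zero]
  intro k
  rw [poissonMeasure_real_singleton, poissonMeasure_real_singleton, Nat.factorial_succ]
  push_cast
  field_simp
  ring

theorem integral_natCast_poissonMeasure (r : ℝ≥0) : ∫ k, (k : ℝ) ∂poissonMeasure r = r := by
  simpa using integral_natCast_mul_poissonMeasure r fun _ => 1

theorem variance_natCast_poissonMeasure (r : ℝ≥0) :
    Var[fun k : ℕ => (k : ℝ); poissonMeasure r] = r := by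
  have integrable_natCast : Integrable (fun k : ℕ => (k : ℝ)) (poissonMeasure r) :=
    (memLp_natCast_poissonMeasure r 1).integrable le_rfl
  have second_moment : ∫ k, (k : ℝ) ^ 2 ∂poissonMeasure r = r * (r + 1) := by
    simp only [sq]
    rw [integral_natCast_mul_poissonMeasure r fun k => (k : ℝ)]
    push_cast
    rw [integral_add integrable_natCast (integrable_const _), integral_natCast_poissonMeasure]
    simp
  rw [variance_eq_sub (memLp_natCast_poissonMeasure r 2), integral_natCast_poissonMeasure]
  simp only [Pi.pow_apply, second_moment]
  ring

end Poisson

section DobinskiLaw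

variable (n : ℕ)

instance : MeasurableSingletonClass (SetPartition n) := ⟨fun _ => trivial⟩

instance : IsProbabilityMeasure (uniformPartition n) := by
  unfold uniformPartition
  infer_instance

/-- The law of the sum of the number of blocks of a uniform random partition of an `n`-element set
and an independent Poisson variable of rate `1`. By Dobiński's formula it charges `k` with a mass
proportional to `k ^ n / k!`, see `dobinskiLaw_real_singleton`. -/
noncomputable def dobinskiLaw : Measure ℕ :=
  ((uniformPartition n).prod (poissonMeasure 1)).map fun ω => ω.1.parts.card + ω.2

instance : IsProbabilityMeasure (dobinskiLaw n) :=
  Measure.isProbabilityMeasure_map .of_discrete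

theorem uniformPartition_real_singleton (P : SetPartition n) :
    (uniformPartition n).real {P} = (Fintype.card (SetPartition n) : ℝ)⁻¹ := by
  simp [uniformPartition, measureReal_def]

theorem poissonMeasure_one_real_setOf_add_eq (b k : ℕ) :
    (poissonMeasure 1).real {j | b + j = k} =
      Real.exp (-1) * k.descFactorial b / k.factorial := by
  rcases lt_or_ge k b with hkb | hbk
  · have : {j | b + j = k} = ∅ := Set.eq_empty_of_forall_notMem fun j hj => by
      simp only [Set.mem_ofPred_eq] at hj
      omega
    simp [this, Nat.descFactorial_of_lt hkb]
  · have : {j | b + j = k} = {k - b} := by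
      ext j
      simp only [Set.mem_ofPred_eq, Set.mem_singleton_iff]
      omega
    rw [this, poissonMeasure_real_singleton, ← Nat.factorial_mul_descFactorial hbk]
    have := (Nat.descFactorial_pos.2 hbk).ne'
    push_cast
    field_simp
    simp

theorem dobinskiLaw_real_singleton (k : ℕ) :
    (dobinskiLaw n).real {k} =
      (Real.exp 1 * Fintype.card (SetPartition n))⁻¹ * (k ^ n / k.factorial) := by
  have fubini : (dobinskiLaw n).real {k} =
      ∫ P, (poissonMeasure 1).real {j | P.parts.card + j = k} ∂uniformPartition n := by
    rw [dobinskiLaw, map_measureReal_apply .of_discrete .of_discrete,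
      ← integral_indicator_one .of_discrete, integral_prod]
    · congr with P
      exact integral_indicator_one .of_discrete
    · exact (integrable_const 1).indicator .of_discrete
  have pow_eq_sum_descFactorial := card_pow_card_eq_sum_descFactorial (α := Fin n) (β := Fin k)
  rw [Fintype.card_fin, Fintype.card_fin] at pow_eq_sum_descFactorial
  rw [fubini, integral_fintype .of_finite, ← Nat.cast_pow, pow_eq_sum_descFactorial, Nat.cast_sum,
    Finset.sum_div, Finset.mul_sum]
  refine Finset.sum_congr rfl fun P _ => ?_
  rw [uniformPartition_real_singleton, poissonMeasure_one_real_setOf_add_eq, Real.exp_neg,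
    smul_eq_mul]
  ring

variable {n}

theorem memLp_numBlocks (p : NNReal) : MemLp (numBlocks n) p (uniformPartition n) :=
  .of_discrete

theorem natCast_comp_card_add :
    ((fun k : ℕ => (k : ℝ)) ∘ fun ω : SetPartition n × ℕ => ω.1.parts.card + ω.2) =
      fun ω => numBlocks n ω.1 + ω.2 :=
  funext fun _ => Nat.cast_add _ _

theorem memLp_natCast_dobinskiLaw (p : NNReal) :
    MemLp (fun k : ℕ => (k : ℝ)) p (dobinskiLaw n) := by
  rw [dobinskiLaw, memLp_map_measure_iff .of_discrete .of_discrete, natCast_comp_card_add]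
  exact ((memLp_numBlocks p).comp_fst _).add ((memLp_natCast_poissonMeasure 1 p).comp_snd _)

theorem integral_natCast_dobinskiLaw : ∫ k, (k : ℝ) ∂dobinskiLaw n = meanBlocks n + 1 := by
  have integrable_numBlocks := (memLp_numBlocks (n := n) 1).integrable le_rfl
  have integrable_poisson := (memLp_natCast_poissonMeasure 1 1).integrable le_rfl
  calc ∫ k, (k : ℝ) ∂dobinskiLaw n
      = ∫ ω, numBlocks n ω.1 + (ω.2 : ℝ) ∂(uniformPartition n).prod (poissonMeasure 1) := by
        rw [dobinskiLaw, integral_map .of_discrete .of_discrete]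
        simp only [Nat.cast_add, numBlocks]
    _ = meanBlocks n + 1 := by
        rw [integral_add (integrable_numBlocks.comp_fst _) (integrable_poisson.comp_snd _),
          integral_fun_fst, integral_fun_snd (fun k : ℕ => (k : ℝ)),
          integral_natCast_poissonMeasure]
        simp [meanBlocks]

theorem variance_natCast_dobinskiLaw :
    Var[fun k : ℕ => (k : ℝ); dobinskiLaw n] = varBlocks n + 1 := by
  rw [dobinskiLaw, variance_map .of_discrete .of_discrete, natCast_comp_card_add,
    variance_add_prod (memLp_numBlocks 2) (memLp_natCast_poissonMeasure 1 2),
    variance_natCast_poissonMeasure, NNReal.coe_one, varBlocks]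

/-- The ratio `w (k - 1) / w k` of the weights `w k = k ^ n / k!` of Dobiński's formula. At
`k = 0`, where `1 / k` is the junk value `0`, it vanishes because of the factor `k`. -/
noncomputable def weightRatio (n k : ℕ) : ℝ := k * (1 - 1 / k) ^ n

theorem integral_succ_dobinskiLaw (g : ℕ → ℝ) :
    ∫ k, g (k + 1) ∂dobinskiLaw n = ∫ k, weightRatio n k * g k ∂dobinskiLaw n := by
  simpa only [one_mul] using integral_mul_succ_eq (p := fun _ => 1) (by simp [weightRatio])
    (fun k => by
      rw [dobinskiLaw_real_singleton, dobinskiLaw_real_singleton, weightRatio, Nat.factorial_succ]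
      push_cast
      have : (1 - 1 / ((k : ℝ) + 1)) = k / (k + 1) := by field_simp; ring
      rw [this, div_pow]
      field_simp) g

end DobinskiLaw

/-- A sequence is bounded by a polynomial; such sequences are integrable with respect to every
measure on `ℕ` all of whose moments are finite. -/
@[fun_prop]
def HasPolyGrowth (f : ℕ → ℝ) : Prop := ∃ N : ℕ, f =O[⊤] fun k => ((k : ℝ) + 1) ^ N

namespace HasPolyGrowth

variable {f g : ℕ → ℝ}

theorem of_abs_le {N : ℕ} (h : ∀ k, |f k| ≤ ((k : ℝ) + 1) ^ N) : HasPolyGrowth f :=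
  ⟨N, .of_norm_le fun k => h k⟩

@[fun_prop]
theorem const (c : ℝ) : HasPolyGrowth fun _ => c :=
  ⟨0, by simpa using isBigO_const_const c (one_ne_zero (α := ℝ)) ⊤⟩

@[fun_prop]
theorem natCast : HasPolyGrowth fun k => (k : ℝ) :=
  of_abs_le (N := 1) fun k => by simp

@[fun_prop]
theorem abs (hf : HasPolyGrowth f) : HasPolyGrowth fun k => |f k| :=
  hf.imp fun _ h => h.abs_left

@[fun_prop]
theorem add (hf : HasPolyGrowth f) (hg : HasPolyGrowth g) : HasPolyGrowth fun k => f k + g k := by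
  obtain ⟨N, hf⟩ := hf
  obtain ⟨M, hg⟩ := hg
  have pow_mono {i j : ℕ} (h : i ≤ j) :
      (fun k : ℕ => ((k : ℝ) + 1) ^ i) =O[⊤] fun k => ((k : ℝ) + 1) ^ j :=
    .of_norm_le fun k => by
      rw [Real.norm_of_nonneg (by positivity)]
      exact pow_le_pow_right₀ (by simp) h
  exact ⟨max N M, (hf.trans (pow_mono (le_max_left N M))).add
    (hg.trans (pow_mono (le_max_right N M)))⟩

@[fun_prop]
theorem mul (hf : HasPolyGrowth f) (hg : HasPolyGrowth g) : HasPolyGrowth fun k => f k * g k := by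
  obtain ⟨N, hf⟩ := hf
  obtain ⟨M, hg⟩ := hg
  exact ⟨N + M, by simpa only [pow_add] using hf.mul hg⟩

@[fun_prop]
theorem sub (hf : HasPolyGrowth f) (hg : HasPolyGrowth g) : HasPolyGrowth fun k => f k - g k := by
  simpa [sub_eq_add_neg] using hf.add ((const (-1)).mul hg)

@[fun_prop]
theorem pow (hf : HasPolyGrowth f) (i : ℕ) : HasPolyGrowth fun k => f k ^ i := by
  obtain ⟨N, hf⟩ := hf
  exact ⟨N * i, by simpa only [pow_mul] using hf.pow i⟩

theorem integrable {ν : Measure ℕ} [IsFiniteMeasure ν]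
    (hν : ∀ p : NNReal, MemLp (fun k : ℕ => (k : ℝ)) p ν) (hf : HasPolyGrowth f) :
    Integrable f ν := by
  obtain ⟨N, hf⟩ := hf
  obtain ⟨C, hC⟩ := isBigO_top.1 hf
  have integrable_pow : Integrable (fun k : ℕ => ‖(k : ℝ) + 1‖ ^ N) ν :=
    ((hν N).add (memLp_const 1)).integrable_norm_pow'
  refine (integrable_pow.const_mul C).mono' .of_discrete (ae_of_all _ fun k => ?_)
  simpa only [norm_pow] using hC k

end HasPolyGrowth

theorem one_sub_one_div_natCast_mem_Icc (k : ℕ) : 1 - 1 / (k : ℝ) ∈ Set.Icc (0 : ℝ) 1 := by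
  rw [one_div]
  exact ⟨sub_nonneg.2 (Nat.cast_inv_le_one k), sub_le_self _ (by positivity)⟩

theorem weightRatio_nonneg (n k : ℕ) : 0 ≤ weightRatio n k :=
  mul_nonneg k.cast_nonneg (pow_nonneg (one_sub_one_div_natCast_mem_Icc k).1 n)

theorem weightRatio_le (n k : ℕ) : weightRatio n k ≤ k :=
  mul_le_of_le_one_right k.cast_nonneg <| pow_le_one₀ (one_sub_one_div_natCast_mem_Icc k).1
    (one_sub_one_div_natCast_mem_Icc k).2

@[fun_prop]
theorem hasPolyGrowth_weightRatio (n : ℕ) : HasPolyGrowth (weightRatio n) :=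
  .of_abs_le (N := 1) fun k => by
    rw [abs_of_nonneg (weightRatio_nonneg n k)]
    linarith [weightRatio_le n k]

theorem HasPolyGrowth.integrable_dobinskiLaw {n : ℕ} {f : ℕ → ℝ} (hf : HasPolyGrowth f) :
    Integrable f (dobinskiLaw n) :=
  hf.integrable memLp_natCast_dobinskiLaw

theorem abs_log_one_sub_add_le {y : ℝ} (hy : |y| ≤ 1 / 2) :
    |Real.log (1 - y) + y + y ^ 2 / 2| ≤ 2 * |y| ^ 3 := by
  have h := Real.abs_log_sub_add_sum_range_le (x := y) (by linarith) 2
  norm_num [Finset.sum_range_succ] at h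
  calc |Real.log (1 - y) + y + y ^ 2 / 2| = |y + y ^ 2 / 2 + Real.log (1 - y)| := by ring_nf
    _ ≤ |y| ^ 3 / (1 - |y|) := h
    _ ≤ 2 * |y| ^ 3 := by
      rw [div_le_iff₀ (by linarith)]
      nlinarith [pow_nonneg (abs_nonneg y) 3]

theorem abs_exp_sub_quadratic_le {u : ℝ} (hu : |u| ≤ 1) :
    |Real.exp u - (1 + u + u ^ 2 / 2)| ≤ |u| ^ 3 := by
  have h := Real.exp_bound hu (n := 3) (by norm_num)
  norm_num [Finset.sum_range_succ, Nat.factorial] at h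
  linarith [pow_nonneg (abs_nonneg u) 3]

theorem abs_one_add_log_div_sub_le {t ε : ℝ} (ht : |t| ≤ 1 / 2) (hε : 0 < ε) (hε' : ε ≤ 1 / 4) :
    |1 + Real.log (1 - ε / (1 + t)) / ε - (t - t ^ 2 - ε / 2)| ≤
      2 * |t| ^ 3 + 5 * ε * |t| + 16 * ε ^ 2 := by
  obtain ⟨ht₁, ht₂⟩ := abs_le.1 ht
  have ht₀ : 0 < 1 + t := by linarith
  have inv_le : |(1 + t)⁻¹| ≤ 2 := by
    rw [abs_of_pos (by positivity), inv_le_comm₀ ht₀ two_pos]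
    linarith
  set y := ε / (1 + t) with hy
  have hy_le : |y| ≤ 2 * ε := by
    rw [hy, div_eq_mul_inv, abs_mul, abs_of_pos hε]
    nlinarith
  have log_error := abs_log_one_sub_add_le (y := y) (by linarith)
  have expansion : 1 + Real.log (1 - y) / ε - (t - t ^ 2 - ε / 2) =
      t ^ 3 * (1 + t)⁻¹ + ε / 2 * (t * (2 + t)) * ((1 + t)⁻¹) ^ 2 +
        (Real.log (1 - y) + y + y ^ 2 / 2) / ε := by
    rw [hy]
    field_simp
    ring
  rw [expansion]
  refine (abs_add_three _ _ _).trans (add_le_add_three ?_ ?_ ?_)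
  · rw [abs_mul, abs_pow, mul_comm]
    gcongr
  · calc |ε / 2 * (t * (2 + t)) * ((1 + t)⁻¹) ^ 2|
        = ε / 2 * (|t| * |2 + t|) * |(1 + t)⁻¹| ^ 2 := by
          rw [abs_mul, abs_mul, abs_mul, abs_pow, abs_of_pos (half_pos hε)]
      _ ≤ ε / 2 * (|t| * (5 / 2)) * 2 ^ 2 := by
          gcongr
          exact abs_le.2 ⟨by linarith, by linarith⟩
      _ = 5 * ε * |t| := by ring
  · rw [abs_div, abs_of_pos hε, div_le_iff₀ hε]
    calc _ ≤ 2 * |y| ^ 3 := log_error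
      _ ≤ 2 * (2 * ε) ^ 3 := by gcongr
      _ = 16 * ε ^ 2 * ε := by ring

theorem abs_mul_one_add_log_div_sub_le {W t ε δ : ℝ} (hW : 1 ≤ W) (hε : 0 < ε)
    (ht : W * |t| ≤ δ) (hεδ : W ^ 2 * ε ≤ δ ^ 2) (hδ : δ ≤ 1 / 10) :
    |W * (1 + Real.log (1 - ε / (1 + t)) / ε) - (W * t - (W * t ^ 2 + W * ε / 2))| ≤
      9 * δ ^ 3 := by
  have hδ₀ : 0 ≤ δ := le_trans (by positivity) ht
  have ht' : |t| ≤ δ := by nlinarith [abs_nonneg t]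
  have hε' : W * ε ≤ δ ^ 2 := by nlinarith [mul_nonneg (by linarith : 0 ≤ W - 1) hε.le]
  have hε'' : ε ≤ δ ^ 2 := by nlinarith
  have log_error := abs_one_add_log_div_sub_le (t := t) (by linarith) hε (by nlinarith)
  calc _ = |W * (1 + Real.log (1 - ε / (1 + t)) / ε - (t - t ^ 2 - ε / 2))| := by ring_nf
    _ ≤ W * (2 * |t| ^ 3 + 5 * ε * |t| + 16 * ε ^ 2) := by
      rw [abs_mul, abs_of_nonneg (by linarith)]
      gcongr
    _ = 2 * (W * |t|) * |t| ^ 2 + 5 * (W * ε) * |t| + 16 * (W * ε) * ε := by ring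
    _ ≤ 2 * δ * δ ^ 2 + 5 * δ ^ 2 * δ + 16 * δ ^ 2 * δ ^ 2 := by gcongr
    _ ≤ 9 * δ ^ 3 := by nlinarith [pow_nonneg hδ₀ 3]

theorem abs_exp_sub_le_of_abs_sub_le {a c u δ : ℝ} (hδ : δ ≤ 1 / 10) (ha : |a| ≤ δ)
    (hc : |c| ≤ 3 / 2 * δ ^ 2) (hu : |u - (a - c)| ≤ 9 * δ ^ 3) :
    |Real.exp u - (1 + a - c + a ^ 2 / 2)| ≤ 22 * δ ^ 3 := by
  have hδ₀ : 0 ≤ δ := (abs_nonneg a).trans ha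
  have hua : |u - a| ≤ 3 * δ ^ 2 := by
    calc |u - a| = |(u - (a - c)) - c| := by ring_nf
      _ ≤ 9 * δ ^ 3 + 3 / 2 * δ ^ 2 := (abs_sub _ _).trans (add_le_add hu hc)
      _ ≤ 3 * δ ^ 2 := by nlinarith [pow_nonneg hδ₀ 2]
  have hu_le : |u| ≤ 2 * δ := by
    calc |u| = |(u - a) + a| := by ring_nf
      _ ≤ 3 * δ ^ 2 + δ := (abs_add_le _ _).trans (add_le_add hua ha)
      _ ≤ 2 * δ := by nlinarith
  have exp_error := abs_exp_sub_quadratic_le (u := u) (by linarith)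
  have square_error : |(u - a) * (u + a) / 2| ≤ 3 * δ ^ 2 * (3 * δ) / 2 := by
    rw [abs_div, abs_mul, abs_two]
    gcongr
    exact (abs_add_le u a).trans (by linarith)
  calc |Real.exp u - (1 + a - c + a ^ 2 / 2)|
      = |(Real.exp u - (1 + u + u ^ 2 / 2)) + (u - (a - c)) + (u - a) * (u + a) / 2| := by ring_nf
    _ ≤ (2 * δ) ^ 3 + 9 * δ ^ 3 + 3 * δ ^ 2 * (3 * δ) / 2 := by
      refine (abs_add_three _ _ _).trans (add_le_add_three (exp_error.trans ?_) hu square_error)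
      gcongr
    _ ≤ 22 * δ ^ 3 := by nlinarith [pow_nonneg hδ₀ 3]

theorem abs_one_add_mul_exp_sub_le {W t ε δ : ℝ} (hW : 1 ≤ W) (hε : 0 < ε)
    (ht : W * |t| ≤ δ) (hεδ : W ^ 2 * ε ≤ δ ^ 2) (hδ : δ ≤ 1 / 10) :
    |(1 + t) * Real.exp (W * (1 + Real.log (1 - ε / (1 + t)) / ε)) -
        (1 - W * ε / 2 + (W + 1) * t + (W * t) ^ 2 / 2)| ≤ 30 * δ ^ 3 := by
  have hδ₀ : 0 ≤ δ := le_trans (by positivity) ht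
  have ht' : |t| ≤ δ := by nlinarith [abs_nonneg t]
  have ha : |W * t| ≤ δ := by rwa [abs_mul, abs_of_nonneg (by linarith)]
  set c := W * t ^ 2 + W * ε / 2 with hc
  have hc_le : |c| ≤ 3 / 2 * δ ^ 2 := by
    have : W * |t| * |t| ≤ δ * δ := by gcongr
    rw [abs_of_nonneg (by positivity), hc, ← sq_abs t]
    nlinarith [mul_nonneg (by linarith : 0 ≤ W - 1) hε.le]
  have exp_error := abs_exp_sub_le_of_abs_sub_le hδ ha hc_le
    (abs_mul_one_add_log_div_sub_le hW hε ht hεδ hδ)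
  set e := Real.exp (W * (1 + Real.log (1 - ε / (1 + t)) / ε))
  calc |(1 + t) * e - (1 - W * ε / 2 + (W + 1) * t + (W * t) ^ 2 / 2)|
      = |(1 + t) * (e - (1 + W * t - c + (W * t) ^ 2 / 2)) + t * (-c + (W * t) ^ 2 / 2)| := by
        rw [hc]; ring_nf
    _ ≤ |1 + t| * (22 * δ ^ 3) + δ * (3 / 2 * δ ^ 2 + δ ^ 2 / 2) := by
        refine (abs_add_le _ _).trans (add_le_add ?_ ?_) <;> rw [abs_mul]
        · gcongr
        · gcongr
          refine (abs_add_le _ _).trans (add_le_add (by rwa [abs_neg]) ?_)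
          rw [abs_of_nonneg (by positivity), ← sq_abs]
          gcongr
    _ ≤ (1 + δ) * (22 * δ ^ 3) + δ * (3 / 2 * δ ^ 2 + δ ^ 2 / 2) := by
        gcongr
        exact (abs_add_le 1 t).trans (by simpa using ht')
    _ ≤ 30 * δ ^ 3 := by nlinarith [pow_nonneg hδ₀ 3]

section Saddle

/-- The point `m = exp W` with `W * exp W = n`, near which the weight `k ^ n / k!` is largest. The
bound `1 ≤ W` only discards small `n`. -/
structure IsSaddle (n : ℕ) (W m : ℝ) : Prop where
  exp_eq : Real.exp W = m
  mul_eq : W * m = n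
  one_le : 1 ≤ W

/-- The quadratic approximation of `weightRatio n k` in terms of `x = k - m`, obtained by expanding
`(1 + x / m) * exp (W + n * log (1 - 1 / k))` in `W * x / m` up to a cubic error, with `1 / m`
counted as a quadratic term. -/
noncomputable def saddleQuadratic (W m x : ℝ) : ℝ :=
  1 - W / (2 * m) + (W + 1) / m * x + W ^ 2 / (2 * m ^ 2) * x ^ 2

variable {n : ℕ} {W m : ℝ}

namespace IsSaddle

theorem pos (h : IsSaddle n W m) : 0 < m := h.exp_eq ▸ Real.exp_pos W

theorem two_mul_le (h : IsSaddle n W m) : 2 * W ≤ m := by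
  have := h.exp_eq ▸ Real.quadratic_le_exp_of_nonneg (zero_le_one.trans h.one_le)
  nlinarith [sq_nonneg (W - 1)]

theorem exp_neg_eq (h : IsSaddle n W m) : Real.exp (-W) = m⁻¹ := by
  rw [Real.exp_neg, h.exp_eq]

theorem weightRatio_le_of_le (h : IsSaddle n W m) {k : ℕ} (hk : k ≤ m) :
    weightRatio n k ≤ k / m := by
  rcases k.eq_zero_or_pos with rfl | hk₀
  · simp [weightRatio]
  have hk₀' : (0 : ℝ) < k := mod_cast hk₀
  rw [weightRatio, div_eq_mul_inv (k : ℝ) m]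
  gcongr
  calc (1 - 1 / (k : ℝ)) ^ n ≤ Real.exp (-(1 / k)) ^ n := by
        gcongr
        · exact (one_sub_one_div_natCast_mem_Icc k).1
        · exact Real.one_sub_le_exp_neg _
    _ = Real.exp (-(W * (m / k))) := by
        rw [← Real.exp_nat_mul, ← h.mul_eq]
        ring_nf
    _ ≤ Real.exp (-W) := by
        gcongr
        exact le_mul_of_one_le_right (by linarith [h.one_le]) ((one_le_div hk₀').2 hk)
    _ = m⁻¹ := h.exp_neg_eq

theorem le_weightRatio_of_le (h : IsSaddle n W m) {k : ℕ} (hk : m ≤ k) :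
    k / m * (1 - W / m) ≤ weightRatio n k := by
  have hm := h.pos
  have hm₁ : 1 ≤ m := by linarith [h.two_mul_le, h.one_le]
  have inv_le : 1 / m ≤ 1 := (div_le_one hm).2 hm₁
  have one_sub_ge : Real.exp (-(1 / m)) * (1 - (1 / m) ^ 2) ≤ 1 - 1 / m := by
    rw [Real.exp_neg, inv_mul_le_iff₀ (Real.exp_pos _)]
    nlinarith [Real.add_one_le_exp (1 / m)]
  rw [weightRatio, div_eq_mul_inv, mul_assoc]
  gcongr
  calc m⁻¹ * (1 - W / m) = Real.exp (-W) * (1 + n * (-(1 / m) ^ 2)) := by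
        rw [h.exp_neg_eq, ← h.mul_eq]
        field_simp
        ring
    _ ≤ Real.exp (-(1 / m)) ^ n * (1 + -(1 / m) ^ 2) ^ n := by
        have : Real.exp (-(1 / m)) ^ n = Real.exp (-W) := by
          rw [← Real.exp_nat_mul, ← h.mul_eq]
          field_simp
        rw [this]
        gcongr
        exact one_add_mul_le_pow (by nlinarith [one_div_pos.2 hm]) n
    _ = (Real.exp (-(1 / m)) * (1 - (1 / m) ^ 2)) ^ n := by rw [mul_pow, sub_eq_add_neg]
    _ ≤ (1 - 1 / m) ^ n := by
        gcongr
        exact mul_nonneg (Real.exp_pos _).le (by nlinarith [one_div_pos.2 hm])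
    _ ≤ (1 - 1 / (k : ℝ)) ^ n := by gcongr

theorem drift_ge (h : IsSaddle n W m) (k : ℕ) :
    (k - m) ^ 2 / (2 * m) - W * |k - m| / m ≤ (k - m) * (weightRatio n k - 1) := by
  have hm := h.pos
  have hW := h.one_le
  rcases le_total (k : ℝ) m with hk | hk
  · have hq := h.weightRatio_le_of_le hk
    rw [abs_of_nonpos (sub_nonpos.2 hk)]
    calc _ ≤ (k - m) ^ 2 / m := by
          have : 0 ≤ W * (m - k) / m := by have := sub_nonneg.2 hk; positivity
          have : (k - m) ^ 2 / (2 * m) ≤ (k - m) ^ 2 / m := by gcongr; linarith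
          linarith [show W * -(k - m) / m = W * (m - k) / m by ring]
      _ = (k - m) * (k / m - 1) := by field_simp
      _ ≤ _ := mul_le_mul_of_nonpos_left (by linarith) (by linarith)
  · have hq := h.le_weightRatio_of_le hk
    have hWm : W / m ≤ 1 / 2 := by
      rw [div_le_iff₀ hm]
      linarith [h.two_mul_le]
    rw [abs_of_nonneg (sub_nonneg.2 hk)]
    calc _ = (k - m) * ((k - m) / m * (1 / 2) - W / m) := by field_simp
      _ ≤ (k - m) * ((k - m) / m * (1 - W / m) - W / m) := by
          gcongr
          linarith
      _ = (k - m) * (k / m * (1 - W / m) - 1) := by field_simp; ring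
      _ ≤ _ := by gcongr

theorem weightRatio_eq_mul_exp (h : IsSaddle n W m) {k : ℕ} (hk : 2 ≤ k) {t ε : ℝ}
    (ht : t = (k - m) / m) (hε : ε = 1 / m) :
    weightRatio n k = (1 + t) * Real.exp (W * (1 + Real.log (1 - ε / (1 + t)) / ε)) := by
  have hm := h.pos
  have hk' : (2 : ℝ) ≤ k := mod_cast hk
  have one_add_t : 1 + t = k / m := by rw [ht]; field_simp; ring
  have quotient : ε / (1 + t) = 1 / k := by rw [hε, one_add_t]; field_simp
  have base_pos : 0 < 1 - 1 / (k : ℝ) := sub_pos.2 ((div_lt_one (by linarith)).2 (by linarith))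
  have exponent : W * (1 + Real.log (1 - 1 / (k : ℝ)) / ε) = W + n * Real.log (1 - 1 / k) := by
    rw [hε, ← h.mul_eq]
    field_simp
  rw [quotient, exponent, Real.exp_add, h.exp_eq, ← Real.log_pow, Real.exp_log (by positivity),
    one_add_t, weightRatio]
  field_simp

theorem abs_weightRatio_sub_saddleQuadratic_le_of_near (h : IsSaddle n W m) {k : ℕ} {δ : ℝ}
    (hδ_eq : δ = W / m * (√m + |k - m|)) (hδ : δ ≤ 1 / 10) :
    |weightRatio n k - saddleQuadratic W m (k - m)| ≤ 30 * δ ^ 3 := by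
  have hm := h.pos
  have hW := h.one_le
  set t := (k - m) / m with ht
  set ε := 1 / m with hε
  have ht_le : W * |t| ≤ δ := by
    rw [hδ_eq, ht, abs_div, abs_of_pos hm]
    calc W * (|k - m| / m) = W / m * |k - m| := by ring
      _ ≤ W / m * (√m + |k - m|) := by gcongr; linarith [Real.sqrt_nonneg m]
  have hε_le : W ^ 2 * ε ≤ δ ^ 2 := by
    calc W ^ 2 * ε = (W / m * √m) ^ 2 := by
          rw [mul_pow, Real.sq_sqrt hm.le, hε]
          field_simp
      _ ≤ δ ^ 2 := by
          rw [hδ_eq]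
          gcongr
          linarith [abs_nonneg (k - m)]
  have hk : 2 ≤ k := by
    have : |t| ≤ 1 / 10 := by nlinarith [abs_nonneg t]
    rw [ht, abs_div, abs_of_pos hm, div_le_iff₀ hm] at this
    have : (1 : ℝ) < k := by linarith [(abs_le.1 this).1, h.two_mul_le]
    exact_mod_cast this
  rw [h.weightRatio_eq_mul_exp hk ht hε]
  convert abs_one_add_mul_exp_sub_le hW (one_div_pos.2 hm) ht_le hε_le hδ using 4
  rw [saddleQuadratic, ht]
  field_simp

theorem abs_saddleQuadratic_le (h : IsSaddle n W m) (x : ℝ) :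
    |saddleQuadratic W m x| ≤ (1 + W / m * (√m + |x|)) ^ 2 := by
  have hm := h.pos
  have hW := h.one_le
  have linear_le : (W + 1) / m * |x| ≤ 2 * (W / m * |x|) := by
    calc (W + 1) / m * |x| ≤ (2 * W) / m * |x| := by gcongr; linarith
      _ = 2 * (W / m * |x|) := by ring
  have sqrt_eq : (W / m * √m) ^ 2 = W ^ 2 / m := by
    rw [mul_pow, Real.sq_sqrt hm.le]
    field_simp
  have constant_le : W / (2 * m) ≤ (W / m * √m) ^ 2 := by
    rw [sqrt_eq]
    gcongr <;> nlinarith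
  have : 0 ≤ W / m * √m := by positivity
  have : 0 ≤ W / m * |x| := by positivity
  calc |saddleQuadratic W m x|
      ≤ 1 + W / (2 * m) + (W + 1) / m * |x| + W ^ 2 / (2 * m ^ 2) * |x| ^ 2 := by
        rw [saddleQuadratic]
        refine (abs_add_le _ _).trans (add_le_add ((abs_add_le _ _).trans (add_le_add
          ((abs_sub _ _).trans ?_) ?_)) ?_)
        · rw [abs_one, abs_of_nonneg (by positivity)]
        · rw [abs_mul, abs_of_nonneg (by positivity)]
        · rw [abs_mul, abs_of_nonneg (by positivity), abs_pow]
    _ = 1 + W / (2 * m) + (W + 1) / m * |x| + (W / m * |x|) ^ 2 / 2 := by ring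
    _ ≤ (1 + W / m * (√m + |x|)) ^ 2 := by
        rw [mul_add]
        nlinarith

theorem abs_weightRatio_sub_saddleQuadratic_le (h : IsSaddle n W m) (k : ℕ) :
    |weightRatio n k - saddleQuadratic W m (k - m)| ≤
      2000 * (W / m * (√m + |k - m|)) ^ 3 * (1 + weightRatio n k) := by
  have hm := h.pos
  have hW := h.one_le
  have hq := weightRatio_nonneg n k
  set δ := W / m * (√m + |k - m|) with hδ
  have hδ₀ : 0 ≤ δ := by positivity
  rcases le_total δ (1 / 10) with hδ_le | hδ_ge
  · calc _ ≤ 30 * δ ^ 3 := h.abs_weightRatio_sub_saddleQuadratic_le_of_near hδ hδ_le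
      _ ≤ 2000 * δ ^ 3 := by gcongr; norm_num
      _ ≤ _ := le_mul_of_one_le_right (by positivity) (by linarith)
  · have square_ge : 1 / 10 * δ ≤ δ ^ 2 := by nlinarith
    have cube_ge : 1 / 10 * δ ^ 2 ≤ δ ^ 3 := by nlinarith [sq_nonneg δ]
    calc |weightRatio n k - saddleQuadratic W m (k - m)|
        ≤ weightRatio n k + (1 + δ) ^ 2 :=
          (abs_sub _ _).trans
            (add_le_add (abs_of_nonneg hq).le (h.abs_saddleQuadratic_le (k - m)))
      _ ≤ 2000 * δ ^ 3 * weightRatio n k + 2000 * δ ^ 3 := by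
          gcongr
          · exact le_mul_of_one_le_left hq (by linarith)
          · nlinarith
      _ = _ := by ring

end IsSaddle

end Saddle

section Moments

/-- The moment of order `i` of `dobinskiLaw n` about the point `m`. -/
noncomputable def momentAbout (n : ℕ) (m : ℝ) (i : ℕ) : ℝ := ∫ k, ((k : ℝ) - m) ^ i ∂dobinskiLaw n

variable {n : ℕ} {W m : ℝ}

theorem momentAbout_zero : momentAbout n m 0 = 1 := by simp [momentAbout]

theorem momentAbout_one : momentAbout n m 1 = meanBlocks n + 1 - m := by
  simp only [momentAbout, pow_one]
  rw [integral_sub (HasPolyGrowth.integrable_dobinskiLaw (by fun_prop)) (integrable_const m),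
    integral_natCast_dobinskiLaw]
  simp

theorem varBlocks_eq_momentAbout :
    varBlocks n = momentAbout n m 2 - momentAbout n m 1 ^ 2 - 1 := by
  have variance_eq : Var[fun k : ℕ => (k : ℝ) - m; dobinskiLaw n] =
      momentAbout n m 2 - momentAbout n m 1 ^ 2 := by
    have memLp : MemLp (fun k : ℕ => (k : ℝ) - m) 2 (dobinskiLaw n) :=
      (memLp_natCast_dobinskiLaw 2).sub (memLp_const m)
    simp [variance_eq_sub memLp, momentAbout]
  rw [← variance_eq, variance_sub_const .of_discrete, variance_natCast_dobinskiLaw,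
    add_sub_cancel_right]

theorem pow_succ_sub_pow_le (x : ℝ) (i : ℕ) :
    (x + 1) ^ (i + 1) - x ^ (i + 1) ≤ (i + 1) * 2 ^ (i - 1) * (|x| ^ i + 1) := by
  calc (x + 1) ^ (i + 1) - x ^ (i + 1)
      ≤ |x + 1 - x| * ↑(i + 1) * max |x + 1| |x| ^ i :=
        (le_abs_self _).trans (abs_pow_sub_pow_le _ _ _)
    _ = (i + 1) * max |x + 1| |x| ^ i := by simp
    _ ≤ (i + 1) * (|x| + 1) ^ i := by
        gcongr
        exact max_le (by simpa using abs_add_le x 1) (by linarith)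
    _ ≤ (i + 1) * (2 ^ (i - 1) * (|x| ^ i + 1 ^ i)) := by
        gcongr
        exact add_pow_le (abs_nonneg x) zero_le_one i
    _ = (i + 1) * 2 ^ (i - 1) * (|x| ^ i + 1) := by ring

namespace IsSaddle

theorem sq_le (h : IsSaddle n W m) : W ^ 2 ≤ 2 * m := by
  have := h.exp_eq ▸ Real.quadratic_le_exp_of_nonneg (zero_le_one.trans h.one_le)
  linarith [h.one_le]

theorem one_le_right (h : IsSaddle n W m) : 1 ≤ m := by linarith [h.two_mul_le, h.one_le]

theorem pow_le_drift (h : IsSaddle n W m) (k i : ℕ) :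
    ((k : ℝ) - m) ^ (2 * (i + 1)) ≤
      4 * m * (weightRatio n k * (k - m) ^ (2 * i + 1) - (k - m) ^ (2 * i + 1)) +
        8 * m * (k - m) ^ (2 * i) := by
  have hm := h.pos
  have hx := h.drift_ge k
  set x := (k : ℝ) - m
  have amgm : 4 * W * |x| ≤ x ^ 2 + 4 * W ^ 2 := by nlinarith [sq_nonneg (|x| - 2 * W), sq_abs x]
  have drift : x ^ 2 ≤ 4 * m * (x * (weightRatio n k - 1)) + 8 * m := by
    have : 2 * m * (x ^ 2 / (2 * m) - W * |x| / m) = x ^ 2 - 2 * W * |x| := by field_simp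
    nlinarith [h.sq_le]
  calc x ^ (2 * (i + 1)) = x ^ (2 * i) * x ^ 2 := by ring
    _ ≤ x ^ (2 * i) * (4 * m * (x * (weightRatio n k - 1)) + 8 * m) := by
        gcongr
        exact (even_two_mul i).pow_nonneg x
    _ = _ := by ring

theorem momentAbout_add_two_le (h : IsSaddle n W m) (i : ℕ) :
    momentAbout n m (2 * (i + 1)) ≤
      4 * m * ((2 * i + 1) * 2 ^ (2 * i - 1) * (momentAbout n m (2 * i) + 1)) +
        8 * m * momentAbout n m (2 * i) := by
  have hm := h.pos
  set C : ℝ := (2 * i + 1) * 2 ^ (2 * i - 1)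
  have integrable {f : ℕ → ℝ} (hf : HasPolyGrowth f) : Integrable f (dobinskiLaw n) :=
    hf.integrable_dobinskiLaw
  have shift : ∫ k, (weightRatio n k * (k - m) ^ (2 * i + 1) - (k - m) ^ (2 * i + 1))
      ∂dobinskiLaw n ≤ C * (momentAbout n m (2 * i) + 1) := by
    rw [integral_sub (integrable (by fun_prop)) (integrable (by fun_prop)),
      ← integral_succ_dobinskiLaw fun k => ((k : ℝ) - m) ^ (2 * i + 1), ← integral_sub
      (integrable (by push_cast; fun_prop)) (integrable (by fun_prop))]
    calc ∫ k : ℕ, (((k + 1 : ℕ) : ℝ) - m) ^ (2 * i + 1) - (k - m) ^ (2 * i + 1) ∂dobinskiLaw n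
        ≤ ∫ k : ℕ, C * (((k : ℝ) - m) ^ (2 * i) + 1) ∂dobinskiLaw n := by
          refine integral_mono (integrable (by push_cast; fun_prop)) (integrable (by fun_prop))
            fun k => ?_
          have := pow_succ_sub_pow_le ((k : ℝ) - m) (2 * i)
          rw [(even_two_mul i).pow_abs, sub_add_eq_add_sub] at this
          simpa [C] using this
      _ = C * (momentAbout n m (2 * i) + 1) := by
          rw [integral_const_mul, integral_add (integrable (by fun_prop)) (integrable_const 1)]
          simp [momentAbout]
  calc momentAbout n m (2 * (i + 1))
      ≤ ∫ k, (4 * m * (weightRatio n k * (k - m) ^ (2 * i + 1) - (k - m) ^ (2 * i + 1)) +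
        8 * m * (k - m) ^ (2 * i)) ∂dobinskiLaw n :=
        integral_mono (integrable (by fun_prop)) (integrable (by fun_prop)) (h.pow_le_drift · i)
    _ = 4 * m * ∫ k, (weightRatio n k * (k - m) ^ (2 * i + 1) - (k - m) ^ (2 * i + 1))
          ∂dobinskiLaw n + 8 * m * momentAbout n m (2 * i) := by
        rw [integral_add (integrable (by fun_prop)) (integrable (by fun_prop)), integral_const_mul,
          integral_const_mul, momentAbout]
    _ ≤ _ := by gcongr

end IsSaddle

theorem exists_momentAbout_two_mul_le (i : ℕ) :
    ∃ C, ∀ {n : ℕ} {W m : ℝ}, IsSaddle n W m → momentAbout n m (2 * i) ≤ C * m ^ i := by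
  induction i with
  | zero => exact ⟨1, fun _ => by simp [momentAbout_zero]⟩
  | succ i ih =>
    obtain ⟨C, hC⟩ := ih
    let K : ℝ := (2 * i + 1) * 2 ^ (2 * i - 1)
    refine ⟨4 * K * (C + 1) + 8 * C, fun {n W m} h => ?_⟩
    have hm := h.pos
    calc momentAbout n m (2 * (i + 1))
        ≤ 4 * m * (K * (momentAbout n m (2 * i) + 1)) + 8 * m * momentAbout n m (2 * i) :=
          h.momentAbout_add_two_le i
      _ ≤ 4 * m * (K * (C * m ^ i + m ^ i)) + 8 * m * (C * m ^ i) := by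
          gcongr
          exacts [hC h, one_le_pow₀ h.one_le_right, hC h]
      _ = (4 * K * (C + 1) + 8 * C) * m ^ (i + 1) := by ring

theorem exists_integral_sqrt_add_abs_pow_le (i : ℕ) :
    ∃ C, ∀ {n : ℕ} {W m : ℝ}, IsSaddle n W m →
      ∫ k, (√m + |(k : ℝ) - m|) ^ i ∂dobinskiLaw n ≤ C * √m ^ i := by
  obtain ⟨C, hC⟩ := exists_momentAbout_two_mul_le i
  refine ⟨2 ^ (2 * i - 1) * (1 + C), fun {n W m} h => ?_⟩
  have hs : 0 < √m := Real.sqrt_pos.2 h.pos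
  refine le_of_mul_le_mul_right ?_ (pow_pos hs i)
  calc (∫ k, (√m + |(k : ℝ) - m|) ^ i ∂dobinskiLaw n) * √m ^ i
      = ∫ k, (√m + |(k : ℝ) - m|) ^ i * √m ^ i ∂dobinskiLaw n := (integral_mul_const _ _).symm
    _ ≤ ∫ k, 2 ^ (2 * i - 1) * (√m ^ (2 * i) + ((k : ℝ) - m) ^ (2 * i)) ∂dobinskiLaw n := by
        refine integral_mono (HasPolyGrowth.integrable_dobinskiLaw (by fun_prop))
          (HasPolyGrowth.integrable_dobinskiLaw (by fun_prop)) fun k => ?_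
        calc (√m + |(k : ℝ) - m|) ^ i * √m ^ i
            ≤ (√m + |(k : ℝ) - m|) ^ i * (√m + |(k : ℝ) - m|) ^ i := by
              gcongr
              exact le_add_of_nonneg_right (abs_nonneg _)
          _ = (√m + |(k : ℝ) - m|) ^ (2 * i) := by ring
          _ ≤ 2 ^ (2 * i - 1) * (√m ^ (2 * i) + |(k : ℝ) - m| ^ (2 * i)) :=
              add_pow_le hs.le (abs_nonneg _) _
          _ = 2 ^ (2 * i - 1) * (√m ^ (2 * i) + ((k : ℝ) - m) ^ (2 * i)) := by
              rw [(even_two_mul i).pow_abs]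
    _ = 2 ^ (2 * i - 1) * (m ^ i + momentAbout n m (2 * i)) := by
        rw [integral_const_mul, integral_add (integrable_const _)
          (HasPolyGrowth.integrable_dobinskiLaw (by fun_prop)), pow_mul √m, Real.sq_sqrt h.pos.le]
        simp [momentAbout]
    _ ≤ 2 ^ (2 * i - 1) * (m ^ i + C * m ^ i) := by
        gcongr
        exact hC h
    _ = 2 ^ (2 * i - 1) * (1 + C) * √m ^ i * √m ^ i := by
        rw [mul_assoc _ (√m ^ i), ← mul_pow, Real.mul_self_sqrt h.pos.le]
        ring

theorem exists_abs_momentAbout_le (i : ℕ) :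
    ∃ C, ∀ {n : ℕ} {W m : ℝ}, IsSaddle n W m → |momentAbout n m i| ≤ C * √m ^ i := by
  obtain ⟨C, hC⟩ := exists_integral_sqrt_add_abs_pow_le i
  refine ⟨C, fun {n W m} h => (abs_integral_le_integral_abs.trans ?_).trans (hC h)⟩
  refine integral_mono (HasPolyGrowth.integrable_dobinskiLaw (by fun_prop))
    (HasPolyGrowth.integrable_dobinskiLaw (by fun_prop)) fun k => ?_
  simp only [abs_pow]
  gcongr
  exact le_add_of_nonneg_left (Real.sqrt_nonneg m)

theorem integral_add_one_sub_pow (n : ℕ) (m : ℝ) (j : ℕ) :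
    ∫ k, ((k : ℝ) + 1 - m) ^ j ∂dobinskiLaw n =
      ∑ i ∈ Finset.range (j + 1), j.choose i * momentAbout n m i := by
  have binomial (k : ℕ) : ((k : ℝ) + 1 - m) ^ j =
      ∑ i ∈ Finset.range (j + 1), j.choose i * ((k : ℝ) - m) ^ i := by
    rw [add_sub_right_comm, add_pow]
    simp [mul_comm]
  simp only [binomial, momentAbout, ← integral_const_mul]
  exact integral_finsetSum _ fun i _ => HasPolyGrowth.integrable_dobinskiLaw (by fun_prop)

theorem integral_saddleQuadratic_mul_pow (n : ℕ) (W m : ℝ) (j : ℕ) :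
    ∫ k, saddleQuadratic W m (k - m) * ((k : ℝ) - m) ^ j ∂dobinskiLaw n =
      (1 - W / (2 * m)) * momentAbout n m j + (W + 1) / m * momentAbout n m (j + 1) +
        W ^ 2 / (2 * m ^ 2) * momentAbout n m (j + 2) := by
  have expand (x : ℝ) : saddleQuadratic W m x * x ^ j =
      (1 - W / (2 * m)) * x ^ j + (W + 1) / m * x ^ (j + 1) +
        W ^ 2 / (2 * m ^ 2) * x ^ (j + 2) := by
    rw [saddleQuadratic]
    ring
  have integrable {f : ℕ → ℝ} (hf : HasPolyGrowth f) : Integrable f (dobinskiLaw n) :=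
    hf.integrable_dobinskiLaw
  simp only [expand, momentAbout]
  rw [integral_add (integrable (by fun_prop)) (integrable (by fun_prop)),
    integral_add (integrable (by fun_prop)) (integrable (by fun_prop))]
  simp only [integral_const_mul]

@[fun_prop]
theorem HasPolyGrowth.saddleQuadratic {f : ℕ → ℝ} (hf : HasPolyGrowth f) (W m : ℝ) :
    HasPolyGrowth fun k => saddleQuadratic W m (f k) := by
  unfold StirlingPartition.saddleQuadratic
  fun_prop

theorem IsSaddle.integral_weightRatio_mul_sqrt_add_abs_pow_le (h : IsSaddle n W m) (i : ℕ) :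
    ∫ k, weightRatio n k * (√m + |(k : ℝ) - m|) ^ i ∂dobinskiLaw n ≤
      2 ^ i * ∫ k, (√m + |(k : ℝ) - m|) ^ i ∂dobinskiLaw n := by
  rw [← integral_succ_dobinskiLaw fun k => (√m + |(k : ℝ) - m|) ^ i, ← integral_const_mul]
  refine integral_mono (HasPolyGrowth.integrable_dobinskiLaw (by push_cast; fun_prop))
    (HasPolyGrowth.integrable_dobinskiLaw (by fun_prop)) fun k => ?_
  have one_le_sqrt : 1 ≤ √m := Real.one_le_sqrt.2 h.one_le_right
  have abs_succ_le : |((k + 1 : ℕ) : ℝ) - m| ≤ |(k : ℝ) - m| + 1 := by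
    simpa [add_sub_right_comm] using abs_add_le ((k : ℝ) - m) 1
  simp only [← mul_pow]
  gcongr
  linarith [abs_nonneg ((k : ℝ) - m)]

theorem IsSaddle.abs_weightRatio_sub_saddleQuadratic_mul_pow_le (h : IsSaddle n W m) (k j : ℕ) :
    |weightRatio n k * ((k : ℝ) - m) ^ j - saddleQuadratic W m (k - m) * ((k : ℝ) - m) ^ j| ≤
      2000 * (W / m) ^ 3 * ((√m + |(k : ℝ) - m|) ^ (j + 3) +
        weightRatio n k * (√m + |(k : ℝ) - m|) ^ (j + 3)) := by
  have abs_le : |(k : ℝ) - m| ≤ √m + |(k : ℝ) - m| :=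
    le_add_of_nonneg_left (Real.sqrt_nonneg m)
  have approx := h.abs_weightRatio_sub_saddleQuadratic_le k
  rw [← sub_mul, abs_mul, abs_pow]
  calc _ ≤ 2000 * (W / m * (√m + |(k : ℝ) - m|)) ^ 3 * (1 + weightRatio n k) *
        (√m + |(k : ℝ) - m|) ^ j := by
        have := (abs_nonneg _).trans approx
        gcongr
    _ = _ := by ring

theorem IsSaddle.abs_integral_succ_sub_le (h : IsSaddle n W m) (j : ℕ) :
    |∫ k, ((k : ℝ) + 1 - m) ^ j ∂dobinskiLaw n -
        ∫ k, saddleQuadratic W m (k - m) * ((k : ℝ) - m) ^ j ∂dobinskiLaw n| ≤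
      2000 * (1 + 2 ^ (j + 3)) * (W / m) ^ 3 *
        ∫ k, (√m + |(k : ℝ) - m|) ^ (j + 3) ∂dobinskiLaw n := by
  have hm := h.pos
  have hW := h.one_le
  have integrable {f : ℕ → ℝ} (hf : HasPolyGrowth f) : Integrable f (dobinskiLaw n) :=
    hf.integrable_dobinskiLaw
  let T (k : ℕ) : ℝ := (√m + |(k : ℝ) - m|) ^ (j + 3)
  have shift : ∫ k, ((k : ℝ) + 1 - m) ^ j ∂dobinskiLaw n =
      ∫ k, weightRatio n k * ((k : ℝ) - m) ^ j ∂dobinskiLaw n := by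
    simpa using integral_succ_dobinskiLaw (n := n) fun k => ((k : ℝ) - m) ^ j
  rw [shift, ← integral_sub (integrable (by fun_prop)) (integrable (by fun_prop))]
  calc _ ≤ ∫ k, 2000 * (W / m) ^ 3 * (T k + weightRatio n k * T k) ∂dobinskiLaw n :=
        abs_integral_le_integral_abs.trans
          (integral_mono (integrable (by fun_prop)) (integrable (by fun_prop))
            (h.abs_weightRatio_sub_saddleQuadratic_mul_pow_le · j))
    _ = 2000 * (W / m) ^ 3 * (∫ k, T k ∂dobinskiLaw n +
          ∫ k, weightRatio n k * T k ∂dobinskiLaw n) := by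
        rw [integral_const_mul, integral_add (integrable (by fun_prop)) (integrable (by fun_prop))]
    _ ≤ 2000 * (W / m) ^ 3 * (∫ k, T k ∂dobinskiLaw n +
          2 ^ (j + 3) * ∫ k, T k ∂dobinskiLaw n) := by
        gcongr
        exact h.integral_weightRatio_mul_sqrt_add_abs_pow_le (j + 3)
    _ = _ := by ring

end Moments

section Asymptotics

variable {ι : Type*} {l : Filter ι} {n : ι → ℕ} {W m : ι → ℝ}

theorem isBigO_of_add_one_mul {f g : ι → ℝ} (hW : ∀ᶠ i in l, 0 ≤ W i)
    (h : (fun i => (W i + 1) * f i) =O[l] fun i => W i * g i) : f =O[l] g := by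
  obtain ⟨C, hC₀, hC⟩ := h.exists_nonneg
  refine .of_bound C ?_
  filter_upwards [hC.bound, hW] with i hi hWi
  rw [norm_mul, norm_mul, Real.norm_of_nonneg hWi, Real.norm_of_nonneg (by positivity)] at hi
  refine le_of_mul_le_mul_left (hi.trans ?_) (by positivity : 0 < W i + 1)
  nlinarith [mul_nonneg hC₀ (norm_nonneg (g i))]

theorem isBigO_one_of_isSaddle (h : ∀ᶠ i in l, IsSaddle (n i) (W i) (m i)) :
    (fun _ => 1 : ι → ℝ) =O[l] W := .of_bound 1 <| by
  filter_upwards [h] with i hi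
  simpa using hi.one_le.trans (le_abs_self _)

theorem isBigO_sqrt_of_isSaddle (h : ∀ᶠ i in l, IsSaddle (n i) (W i) (m i)) :
    W =O[l] fun i => √(m i) := by
  refine .of_bound √2 ?_
  filter_upwards [h] with i hi
  rw [Real.norm_of_nonneg (Real.sqrt_nonneg _), ← Real.sqrt_mul zero_le_two]
  exact Real.abs_le_sqrt hi.sq_le

theorem isBigO_momentAbout (h : ∀ᶠ i in l, IsSaddle (n i) (W i) (m i)) (j : ℕ) :
    (fun i => momentAbout (n i) (m i) j) =O[l] fun i => √(m i) ^ j := by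
  obtain ⟨C, hC⟩ := exists_abs_momentAbout_le j
  refine .of_bound C ?_
  filter_upwards [h] with i hi
  rw [norm_pow, Real.norm_of_nonneg (Real.sqrt_nonneg _)]
  exact hC hi

theorem isBigO_momentAbout_two_mul (h : ∀ᶠ i in l, IsSaddle (n i) (W i) (m i)) (j : ℕ) :
    (fun i => momentAbout (n i) (m i) (2 * j)) =O[l] fun i => m i ^ j := by
  refine (isBigO_momentAbout h (2 * j)).congr' .rfl (h.mono fun i hi => ?_)
  simp only [pow_mul, Real.sq_sqrt hi.pos.le]

theorem isBigO_integral_add_one_sub_pow_sub (h : ∀ᶠ i in l, IsSaddle (n i) (W i) (m i)) (j : ℕ) :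
    (fun i => ∫ k, ((k : ℝ) + 1 - m i) ^ j ∂dobinskiLaw (n i) -
        ∫ k, saddleQuadratic (W i) (m i) (k - m i) * ((k : ℝ) - m i) ^ j ∂dobinskiLaw (n i)) =O[l]
      fun i => (W i / m i) ^ 3 * √(m i) ^ (j + 3) := by
  obtain ⟨C, hC⟩ := exists_integral_sqrt_add_abs_pow_le (j + 3)
  refine .of_bound (2000 * (1 + 2 ^ (j + 3)) * C) ?_
  filter_upwards [h] with i hi
  have := hi.pos
  have := hi.one_le
  rw [Real.norm_of_nonneg (by positivity : 0 ≤ (W i / m i) ^ 3 * √(m i) ^ (j + 3))]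
  calc _ ≤ 2000 * (1 + 2 ^ (j + 3)) * (W i / m i) ^ 3 *
        ∫ k, (√(m i) + |(k : ℝ) - m i|) ^ (j + 3) ∂dobinskiLaw (n i) :=
        hi.abs_integral_succ_sub_le j
    _ ≤ 2000 * (1 + 2 ^ (j + 3)) * (W i / m i) ^ 3 * (C * √(m i) ^ (j + 3)) := by
        gcongr
        exact hC hi
    _ = _ := by ring

theorem isBigO_mul_integral_add_one_sub_pow_sub (h : ∀ᶠ i in l, IsSaddle (n i) (W i) (m i)) (j : ℕ)
    {u : ι → ℝ} (hu : (fun i => W i * √(m i) ^ j) =O[l] fun i => √(m i) * u i) :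
    (fun i => m i * (∫ k, ((k : ℝ) + 1 - m i) ^ j ∂dobinskiLaw (n i) -
        ∫ k, saddleQuadratic (W i) (m i) (k - m i) * ((k : ℝ) - m i) ^ j ∂dobinskiLaw (n i))) =O[l]
      fun i => W i ^ 2 * u i := by
  refine ((isBigO_refl m l).mul (isBigO_integral_add_one_sub_pow_sub h j)).trans ?_
  refine ((isBigO_refl (fun i => W i ^ 2 / √(m i)) l).mul hu).congr' ?_ ?_
  · filter_upwards [h] with i hi
    obtain ⟨s, hs, hm⟩ : ∃ s, 0 < s ∧ m i = s ^ 2 :=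
      ⟨√(m i), Real.sqrt_pos.2 hi.pos, (Real.sq_sqrt hi.pos.le).symm⟩
    rw [hm, Real.sqrt_sq hs.le]
    field_simp
    ring
  · filter_upwards [h] with i hi
    have := Real.sqrt_pos.2 hi.pos
    field_simp

/- For even `j` this is applied with `u = m ^ (j / 2)`, but for `j = 1` with `u = W` in place of the
generic order `√m`: the odd moments are smaller because the distribution is nearly symmetric. -/
theorem isBigO_momentAbout_recurrence (h : ∀ᶠ i in l, IsSaddle (n i) (W i) (m i)) (j : ℕ)
    {u : ι → ℝ} (hj : (fun i => momentAbout (n i) (m i) j) =O[l] u)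
    (hj₂ : (fun i => momentAbout (n i) (m i) (j + 2)) =O[l] fun i => m i * u i)
    (hu : (fun i => W i * √(m i) ^ j) =O[l] fun i => √(m i) * u i) :
    (fun i => (W i + 1) * momentAbout (n i) (m i) (j + 1) -
        m i * ∑ p ∈ Finset.range j, j.choose p * momentAbout (n i) (m i) p) =O[l]
      fun i => W i ^ 2 * u i := by
  have constant_term : (fun i => W i / 2 * momentAbout (n i) (m i) j) =O[l]
      fun i => W i ^ 2 * u i := by
    have : (fun i => 1 / 2 * W i * 1 * momentAbout (n i) (m i) j) =O[l] fun i => W i * W i * u i :=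
      (((isBigO_refl W l).const_mul_left _).mul (isBigO_one_of_isSaddle h)).mul hj
    exact this.congr (fun i => by ring) fun i => by ring
  have quadratic_term : (fun i => W i ^ 2 / (2 * m i) * momentAbout (n i) (m i) (j + 2)) =O[l]
      fun i => W i ^ 2 * u i := by
    have : (fun i => 1 / 2 * (W i ^ 2 / m i) * momentAbout (n i) (m i) (j + 2)) =O[l]
        fun i => W i ^ 2 / m i * (m i * u i) :=
      ((isBigO_refl (fun i => W i ^ 2 / m i) l).const_mul_left _).mul hj₂
    refine this.congr' (.of_forall fun i => by ring) (h.mono fun i hi => ?_)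
    have := hi.pos
    field_simp
  have remainder := isBigO_mul_integral_add_one_sub_pow_sub h j hu
  refine ((constant_term.sub quadratic_term).sub remainder).congr' ?_ .rfl
  filter_upwards [h] with i hi
  have := hi.pos
  rw [integral_add_one_sub_pow, Finset.sum_range_succ, integral_saddleQuadratic_mul_pow]
  simp only [Nat.choose_self, Nat.cast_one, one_mul]
  field_simp
  ring

theorem isBigO_momentAbout_one (h : ∀ᶠ i in l, IsSaddle (n i) (W i) (m i)) :
    (fun i => momentAbout (n i) (m i) 1) =O[l] W := by
  refine isBigO_of_add_one_mul (h.mono fun i hi => zero_le_one.trans hi.one_le) ?_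
  have recurrence := isBigO_momentAbout_recurrence h 0 (u := fun _ => 1)
    (by simpa only [pow_zero] using isBigO_momentAbout_two_mul h 0)
    (by simpa only [pow_one, mul_one] using isBigO_momentAbout_two_mul h 1)
    (by simpa only [pow_zero, mul_one] using isBigO_sqrt_of_isSaddle h)
  simpa [sq] using recurrence

theorem isBigO_momentAbout_three (h : ∀ᶠ i in l, IsSaddle (n i) (W i) (m i)) :
    (fun i => momentAbout (n i) (m i) 3) =O[l] fun i => m i * W i := by
  refine isBigO_of_add_one_mul (h.mono fun i hi => zero_le_one.trans hi.one_le) ?_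
  have sqrt_sq : (fun i => √(m i) ^ 2) =ᶠ[l] m := h.mono fun i hi => Real.sq_sqrt hi.pos.le
  have recurrence := isBigO_momentAbout_recurrence h 2 (u := m)
    (by simpa only [pow_one] using isBigO_momentAbout_two_mul h 1)
    (by simpa only [sq] using isBigO_momentAbout_two_mul h 2)
    ((isBigO_sqrt_of_isSaddle h).mul sqrt_sq.isBigO)
  have lower : (fun i => m i * (1 + 2 * momentAbout (n i) (m i) 1)) =O[l]
      fun i => m i * W i * W i := by
    have one := isBigO_one_of_isSaddle h
    have := (one.add ((isBigO_momentAbout_one h).const_mul_left 2)).mul one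
    exact ((isBigO_refl m l).mul this).congr (fun i => by simp) fun i => by ring
  refine (recurrence.congr_right (g₂ := fun i => m i * W i * W i) fun i => by ring).add lower
    |>.congr (fun i => ?_) fun i => by ring
  simp [Finset.sum_range_succ, momentAbout_zero]

theorem isBigO_momentAbout_two_sub (h : ∀ᶠ i in l, IsSaddle (n i) (W i) (m i)) :
    (fun i => momentAbout (n i) (m i) 2 - m i / (W i + 1)) =O[l] fun i => W i ^ 2 := by
  refine isBigO_of_add_one_mul (h.mono fun i hi => zero_le_one.trans hi.one_le) ?_
  have recurrence := isBigO_momentAbout_recurrence h 1 (isBigO_momentAbout_one h)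
    (isBigO_momentAbout_three h)
    (by simpa [mul_comm] using isBigO_refl (fun i => W i * √(m i)) l)
  refine recurrence.congr' (h.mono fun i hi => ?_) (.of_forall fun i => by ring)
  have := hi.one_le
  simp only [Finset.sum_range_one, Nat.choose_zero_right, Nat.cast_one, momentAbout_zero, mul_one]
  field_simp

end Asymptotics

theorem tendsto_lambertW_natCast_atTop : Tendsto (fun n : ℕ => lambertW n) atTop atTop := by
  refine tendsto_atTop.2 fun b => ?_
  filter_upwards [eventually_gt_atTop 0,
    tendsto_natCast_atTop_atTop.eventually_gt_atTop (b * Real.exp b)] with n hn hb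
  obtain ⟨hW, hW_eq⟩ := lambertW_spec (x := n) (mod_cast hn)
  by_contra! hlt
  have := hW.trans hlt
  have : lambertW n * Real.exp (lambertW n) ≤ b * Real.exp b := by gcongr
  linarith

theorem eventually_isSaddle_lambertW_mu : ∀ᶠ n : ℕ in atTop, IsSaddle n (lambertW n) (mu n) := by
  filter_upwards [eventually_gt_atTop 0,
    tendsto_lambertW_natCast_atTop.eventually_ge_atTop 1] with n hn one_le
  obtain ⟨hW, hW_eq⟩ := lambertW_spec (x := n) (mod_cast hn)
  exact ⟨by rw [mu, eq_div_iff hW.ne', mul_comm, hW_eq], mul_div_cancel₀ _ hW.ne', one_le⟩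

end StirlingPartition

theorem mainTheorem3 :
    ((fun n : ℕ => StirlingPartition.meanBlocks n - StirlingPartition.mu n)
        =O[atTop] fun n : ℕ => StirlingPartition.lambertW (n : ℝ)) ∧
    ((fun n : ℕ => StirlingPartition.varBlocks n - StirlingPartition.sigmaSq n)
        =O[atTop] fun n : ℕ => StirlingPartition.lambertW (n : ℝ) ^ 2) := by
  open StirlingPartition in
  have saddle := eventually_isSaddle_lambertW_mu
  have e₁ := isBigO_momentAbout_one saddle
  have one := isBigO_one_of_isSaddle saddle
  constructor
  · refine (e₁.sub one).congr_left fun n => ?_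
    rw [momentAbout_one]
    ring
  · have := ((isBigO_momentAbout_two_sub saddle).sub (e₁.pow 2)).sub (one.pow 2)
    refine this.congr_left fun n => ?_
    rw [varBlocks_eq_momentAbout (m := mu n), sigmaSq, mu, div_div]
    ring
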